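/- Let $n\ge 1$, let $\Omega\subset\mathbb R^n$ be a Borel set, $\lambda$ Lebesgue measure, and let $F\subset\overline\Omega$ be closed with $\lambda(F\cap\Omega)=0$. Let $F_\delta$ denote the open $\delta$-neighbourhood of $F$ (with $\emptyset_\delta=\emptyset$). Let $\mathrm{ba}_w(\lambda)$ be the set of bounded finitely additive $\mu:\mathcal B(\Omega)\to\mathbb R$ on the Borel subsets of $\Omega$ with $\mu(A)=0$ whenever $\lambda(A)=0$; $|\mu|$ denotes the total variation of $\mu$. The integral $\int_\Omega f\,d\mu$ is the limit of $\int_\Omega s_k\,d\mu$ for simple Borel functions $s_k$ that converge to $f$ in $|\mu|$-measure (i.e. for every $\varepsilon>0$, $\inf\{|\mu|(A): A\in\mathcal B(\Omega),\ A\supset\{|s_k-f|>\varepsilon\}\}\to0$) and satisfy $\int_\Omega|s_k-s_l|\,d|\mu|\to0$ as $k,l\to\infty$, and $\int_A f\,d\mu:=\int_\Omega f\,\mathbf 1_A\,d\mu$. A measure $\mu\in\mathrm{ba}_w(\lambda)$ is called a density measure for $F$ if $\mu\ge0$ and $\mu(F_\delta\cap\Omega)=\mu(\Omega)=1$ for all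 $\delta>0$. Let $\mu\in\mathrm{ba}_w(\lambda)$. Then $\mu$ is a density measure for $F$ if and only if there exists $\nu\in\mathrm{ba}_w(\lambda)$, $\nu\ge 0$, with $\nu(F_\delta\cap\Omega)>0$ for all $\delta>0$, such that for every $f\in L^\infty(\Omega,\lambda)$ $$\int_\Omega f\,d\mu\;\le\;\limsup_{\delta\downarrow0}\frac1{\nu(F_\delta\cap\Omega)}\int_{F_\delta\cap\Omega}f\,d\nu .$$ Moreover, for every such $\nu$ and every $f\in L^\infty(\Omega,\lambda)$ for which the limit exists in $\mathbb R$, $$\int_F f\,d\mu=\lim_{\delta\downarrow0}\frac1{\nu(F_\delta\cap\Omega)}\int_{F_\delta\cap\Omega}f\,d\nu .$$ Here $\int_F f\,d\mu$ denotes the common value of $\int_{F_\delta\cap\Omega}f\,d\mu$ for all $\delta>0$; that it is well defined is part of the claim: the core $\{x\in\mathbb R^n: |\mu|(U\cap\Omega)>0\text{ for every open }U\ni x\}$ of $\mu$ is contained in $F$, $f\,\mathbf 1_{F_\delta\cap\Omega}$ is $\mu$-integrable for every $\delta>0$, and the value does not depend on $\delta$. -/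

import Mathlib

open MeasureTheory Filter Topology Set
open scoped ENNReal

noncomputable section

namespace FinAdd

/-! ### Finitely additive measures on the σ-algebra of a measurable space -/

section General

variable {X : Type*} [MeasurableSpace X]

/-- Real-valued finitely additive set functions on the σ-algebra of all measurable subsets of `X`.
Values at non-measurable sets carry no information and are never used. -/
abbrev FAMeasure (X : Type*) [MeasurableSpace X] : Type _ :=
  AddContent ℝ {A : Set X | MeasurableSet A}

/-- Boundedness on the measurable sets: membership in `ba(X)`. -/
def IsBdd (μ : FAMeasure X) : Prop :=
  ∃ C : ℝ, ∀ A : Set X, MeasurableSet A → |μ A| ≤ C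

/-- Weak absolute continuity of `μ` with respect to the σ-additive measure `lam`. -/
def IsWeaklyAC (μ : FAMeasure X) (lam : Measure X) : Prop :=
  ∀ A : Set X, MeasurableSet A → lam A = 0 → μ A = 0

/-- The space `ba_w(lam)` of bounded finitely additive measures that are weakly absolutely
continuous with respect to `lam`. -/
def baw (lam : Measure X) : Set (FAMeasure X) :=
  {μ | IsBdd μ ∧ IsWeaklyAC μ lam}

/-- `μ ≥ 0` in the setwise order. -/
def IsNonneg (μ : FAMeasure X) : Prop :=
  ∀ A : Set X, MeasurableSet A → 0 ≤ μ A

/-- The total variation `|μ|(A)` of a bounded `μ` on a measurable set `A`: the supremum of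
`∑ |μ (A_k)|` over all finite partitions of `A` into measurable sets. -/
def totalVar (μ : FAMeasure X) (A : Set X) : ℝ :=
  sSup {r : ℝ | ∃ P : Finset (Set X), (∀ B ∈ P, MeasurableSet B) ∧
    (P : Set (Set X)).PairwiseDisjoint id ∧ ⋃₀ (P : Set (Set X)) = A ∧ r = ∑ B ∈ P, |μ B|}

/-- The outer measure `|μ|^*(B)` of an arbitrary set `B`: the infimum of `|μ|(A)` over the
measurable `A ⊇ B`. -/
def outerVar (μ : FAMeasure X) (B : Set X) : ℝ :=
  sInf {r : ℝ | ∃ A : Set X, MeasurableSet A ∧ B ⊆ A ∧ r = totalVar μ A}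

/-- The integral of a simple function with respect to a real-valued set function. -/
def simpleIntegral (m : Set X → ℝ) (s : SimpleFunc X ℝ) : ℝ :=
  ∑ y ∈ s.range, y * m (s ⁻¹' {y})

/-- `s k` converges to `f` in measure with respect to `μ`. -/
def ConvInMeasure (μ : FAMeasure X) (s : ℕ → X → ℝ) (f : X → ℝ) : Prop :=
  ∀ ε : ℝ, 0 < ε → Tendsto (fun k => outerVar μ {x | ε < |s k x - f x|}) atTop (𝓝 0)

/-- `s` is a determining sequence for the integral of `f`: simple functions that converge to `f`
in measure and satisfy `∫ |s k - s l| d|μ| → 0` as `k, l → ∞`. -/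
def IsDetermining (μ : FAMeasure X) (f : X → ℝ) (s : ℕ → SimpleFunc X ℝ) : Prop :=
  ConvInMeasure μ (fun k => s k) f ∧
  Tendsto (fun p : ℕ × ℕ => simpleIntegral (totalVar μ) ((s p.1 - s p.2).map fun t => |t|))
    atTop (𝓝 0)

/-- Integrability of `f` with respect to `μ`: existence of a determining sequence. -/
def IsIntegrable (μ : FAMeasure X) (f : X → ℝ) : Prop :=
  ∃ s : ℕ → SimpleFunc X ℝ, IsDetermining μ f s

open Classical in
/-- The integral `∫ f dμ`: the limit of `∫ s k dμ` along a determining sequence of `f`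
(and `0` if `f` is not integrable). -/
def integral (μ : FAMeasure X) (f : X → ℝ) : ℝ :=
  if h : IsIntegrable μ f then
    limUnder atTop fun k => simpleIntegral (fun A => μ A) (h.choose k)
  else 0

/-- The integral `∫_A f dμ` over a subset. -/
def setIntegral (μ : FAMeasure X) (A : Set X) (f : X → ℝ) : ℝ :=
  integral μ (A.indicator f)

/-- The mean of `f` over `A` with respect to `ν` (used only when `ν A > 0`). -/
def setMean (ν : FAMeasure X) (A : Set X) (f : X → ℝ) : ℝ :=
  setIntegral ν A f / ν A

end General

/-! ### Density measures on a subset of Euclidean space -/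

section Euclidean

variable {n : ℕ} {Ω : Set (EuclideanSpace ℝ (Fin n))}

/-- Lebesgue measure on the Borel subsets of `Ω`. -/
def lebOn (Ω : Set (EuclideanSpace ℝ (Fin n))) : Measure Ω :=
  Measure.comap Subtype.val volume

/-- `F_δ ∩ Ω` as a subset of `Ω`, where `F_δ` is the open `δ`-neighbourhood of `F`. -/
def nhdIn (Ω F : Set (EuclideanSpace ℝ (Fin n))) (δ : ℝ) : Set Ω :=
  Subtype.val ⁻¹' Metric.thickening δ F

/-- The core of `μ`: the points of `ℝⁿ` (not necessarily in `Ω`) all of whose open neighbourhoods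
`U` satisfy `|μ|(U ∩ Ω) > 0`. -/
def core (μ : FAMeasure Ω) : Set (EuclideanSpace ℝ (Fin n)) :=
  {x | ∀ U : Set (EuclideanSpace ℝ (Fin n)), IsOpen U → x ∈ U →
    0 < totalVar μ (Subtype.val ⁻¹' U)}

/-- `μ` is a density measure for `F`. -/
structure IsDensityMeasure (μ : FAMeasure Ω) (F : Set (EuclideanSpace ℝ (Fin n))) : Prop where
  mem_baw : μ ∈ baw (lebOn Ω)
  nonneg : IsNonneg μ
  total : μ univ = 1
  conc : ∀ δ : ℝ, 0 < δ → μ (nhdIn Ω F δ) = 1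

/-- `∫_F f dμ` is defined and equals `I`: the core of `μ` lies in `F`, and for every `δ > 0` the
function `f` is integrable over `F_δ ∩ Ω` with `∫_{F_δ ∩ Ω} f dμ = I`, independently of `δ`. -/
def HasCoreIntegral (μ : FAMeasure Ω) (F : Set (EuclideanSpace ℝ (Fin n))) (f : Ω → ℝ)
    (I : ℝ) : Prop :=
  core μ ⊆ F ∧ ∀ δ : ℝ, 0 < δ →
    IsIntegrable μ ((nhdIn Ω F δ).indicator f) ∧ setIntegral μ (nhdIn Ω F δ) f = I

/-- `ν` is a nonnegative element of `ba_w(lam)` charging every `F_δ ∩ Ω`, and `∫ f dμ` is at most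
the upper limit, as `δ ↓ 0`, of the `ν`-means of `f` over `F_δ ∩ Ω`, for all `f ∈ L^∞(Ω)`.
The upper limit is taken in the extended reals. -/
structure DominatesMeans (ν μ : FAMeasure Ω) (F : Set (EuclideanSpace ℝ (Fin n))) : Prop where
  mem_baw : ν ∈ baw (lebOn Ω)
  nonneg : IsNonneg ν
  charges : ∀ δ : ℝ, 0 < δ → 0 < ν (nhdIn Ω F δ)
  le_limsup : ∀ f : Ω → ℝ, MemLp f ∞ (lebOn Ω) →
    ((integral μ f : ℝ) : EReal) ≤
      limsup (fun δ : ℝ => ((setMean ν (nhdIn Ω F δ) f : ℝ) : EReal)) (𝓝[>] (0 : ℝ))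

end Euclidean

end FinAdd

end

/-! If `μ` is a density measure, its variation vanishes off every `F_δ ∩ Ω`, so the `μ`-means of `f`
over `F_δ ∩ Ω` all equal `∫ f dμ`; hence `ν = μ` works.

Conversely, apply the upper bound to `f` and `-f`: whenever the `ν`-means of `f` converge, their
limit is `∫ f dμ` (`integral_eq_of_tendsto`). For the indicator of a measurable set containing some
`F_δ ∩ Ω` the means are eventually 1, so `μ` gives such sets mass 1 (`apply_eq_one`). The bound for
`-1_A` gives `μ A ≥ 0`. So `μ` is a density measure, and the integral formula follows because
cutting `f` down to `F_δ ∩ Ω` changes it only on a `|μ|`-null set.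

Most of the work is the integral itself. It is defined by a chosen determining sequence, so its
value must be shown independent of the choice (`IsDetermining.integral_eq`). This rests on finite
additivity of `|μ|` (`isFinAdditive_totalVar`) and on the fact that an `L¹`-Cauchy sequence of
simple functions tending to 0 in measure tends to 0 in `L¹` (`tendsto_simpleNorm_zero`). -/

namespace FinAdd

/-! ### Simple integrals against finitely additive set functions. -/

section SetFunctions

variable {X : Type*} [MeasurableSpace X]

/-- Finite additivity of a real set function on the measurable sets. -/
structure IsFinAdditive (m : Set X → ℝ) : Prop where
  empty : m ∅ = 0
  union : ∀ s t, MeasurableSet s → MeasurableSet t → Disjoint s t → m (s ∪ t) = m s + m t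

/-- Relative to the zero measure every set has finite measure and every simple function is
integrable, so the `setToSimpleFunc` calculus applies without any σ-additivity. -/
theorem IsFinAdditive.finMeasAdditive {m : Set X → ℝ} (hm : IsFinAdditive m) :
    FinMeasAdditive (0 : Measure X) (fun A => m A • ContinuousLinearMap.id ℝ ℝ) := by
  intro s t hs ht _ _ hd
  simp only [hm.union s t hs ht hd, add_smul]

theorem simpleIntegral_eq_setToSimpleFunc (m : Set X → ℝ) (s : SimpleFunc X ℝ) :
    simpleIntegral m s = s.setToSimpleFunc (fun A => m A • ContinuousLinearMap.id ℝ ℝ) := by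
  simp [simpleIntegral, SimpleFunc.setToSimpleFunc, mul_comm]

namespace IsFinAdditive

variable {m : Set X → ℝ}

theorem simpleIntegral_add (hm : IsFinAdditive m) (s t : SimpleFunc X ℝ) :
    simpleIntegral m (s + t) = simpleIntegral m s + simpleIntegral m t := by
  simp only [simpleIntegral_eq_setToSimpleFunc]
  exact SimpleFunc.setToSimpleFunc_add _ hm.finMeasAdditive integrable_zero_measure
    integrable_zero_measure

theorem simpleIntegral_sub (hm : IsFinAdditive m) (s t : SimpleFunc X ℝ) :
    simpleIntegral m (s - t) = simpleIntegral m s - simpleIntegral m t := by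
  simp only [simpleIntegral_eq_setToSimpleFunc]
  exact SimpleFunc.setToSimpleFunc_sub _ hm.finMeasAdditive integrable_zero_measure
    integrable_zero_measure

theorem simpleIntegral_neg (hm : IsFinAdditive m) (s : SimpleFunc X ℝ) :
    simpleIntegral m (-s) = -simpleIntegral m s := by
  simp only [simpleIntegral_eq_setToSimpleFunc]
  exact SimpleFunc.setToSimpleFunc_neg _ hm.finMeasAdditive integrable_zero_measure

theorem simpleIntegral_map (hm : IsFinAdditive m) (s : SimpleFunc X ℝ) {g : ℝ → ℝ}
    (hg : g 0 = 0) :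
    simpleIntegral m (s.map g) = ∑ y ∈ s.range, g y * m (s ⁻¹' {y}) := by
  rw [simpleIntegral_eq_setToSimpleFunc,
    SimpleFunc.map_setToSimpleFunc _ hm.finMeasAdditive integrable_zero_measure hg]
  simp [mul_comm]

theorem simpleIntegral_const (hm : IsFinAdditive m) (c : ℝ) :
    simpleIntegral m (SimpleFunc.const X c) = c * m univ := by
  rw [simpleIntegral_eq_setToSimpleFunc, SimpleFunc.setToSimpleFunc_const _ (by simp [hm.empty])]
  simp [mul_comm]

theorem simpleIntegral_indicator (hm : IsFinAdditive m) {A : Set X} (hA : MeasurableSet A)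
    (c : ℝ) :
    simpleIntegral m (SimpleFunc.piecewise A hA (SimpleFunc.const X c) (SimpleFunc.const X 0)) =
      c * m A := by
  rw [simpleIntegral_eq_setToSimpleFunc,
    SimpleFunc.setToSimpleFunc_indicator _ (by simp [hm.empty])]
  simp [mul_comm]

theorem simpleIntegral_mono (hm : IsFinAdditive m) (h0 : ∀ A, MeasurableSet A → 0 ≤ m A)
    {s t : SimpleFunc X ℝ} (hst : s ≤ t) : simpleIntegral m s ≤ simpleIntegral m t := by
  simp only [simpleIntegral_eq_setToSimpleFunc]
  refine SimpleFunc.setToSimpleFunc_mono hm.finMeasAdditive (fun A hA _ x hx => ?_)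
    integrable_zero_measure integrable_zero_measure hst
  simpa using mul_nonneg (h0 A hA) hx

theorem simpleIntegral_nonneg (hm : IsFinAdditive m) (h0 : ∀ A, MeasurableSet A → 0 ≤ m A)
    {s : SimpleFunc X ℝ} (hs : 0 ≤ s) : 0 ≤ simpleIntegral m s := by
  have h := hm.simpleIntegral_mono h0 hs
  have h' := hm.simpleIntegral_const 0
  rw [zero_mul] at h'
  exact h'.symm.le.trans h

theorem mono (hm : IsFinAdditive m) (h0 : ∀ A, MeasurableSet A → 0 ≤ m A)
    {A B : Set X} (hA : MeasurableSet A) (hB : MeasurableSet B) (h : A ⊆ B) : m A ≤ m B := by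
  have := hm.union A (B \ A) hA (hB.diff hA) disjoint_sdiff_right
  rw [union_sdiff_cancel h] at this
  linarith [h0 _ (hB.diff hA)]

theorem union_le (hm : IsFinAdditive m) (h0 : ∀ A, MeasurableSet A → 0 ≤ m A)
    {A B : Set X} (hA : MeasurableSet A) (hB : MeasurableSet B) : m (A ∪ B) ≤ m A + m B := by
  have := hm.union A (B \ A) hA (hB.diff hA) disjoint_sdiff_right
  rw [union_sdiff_self] at this
  linarith [hm.mono h0 (hB.diff hA) hB sdiff_subset]

end IsFinAdditive

theorem isFinAdditive_coe (μ : FAMeasure X) : IsFinAdditive (fun A => μ A) :=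
  ⟨addContent_empty, fun _ _ hs ht hd => addContent_union' hs ht (hs.union ht) hd⟩

/-! ### The total variation -/

theorem totalVar_nonneg (μ : FAMeasure X) (A : Set X) : 0 ≤ totalVar μ A := by
  refine Real.sSup_nonneg ?_
  rintro r ⟨P, -, -, -, rfl⟩
  exact Finset.sum_nonneg fun _ _ => abs_nonneg _

/-- Split the family by the sign of `μ B`: each half sums to `±μ` of its union, which costs at most
`C`. This makes the supremum defining `totalVar` finite. -/
theorem sum_abs_le_of_bound {μ : FAMeasure X} {C : ℝ}
    (hC : ∀ A : Set X, MeasurableSet A → |μ A| ≤ C) {P : Finset (Set X)}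
    (hP : ∀ B ∈ P, MeasurableSet B) (hd : (P : Set (Set X)).PairwiseDisjoint id) :
    ∑ B ∈ P, |μ B| ≤ 2 * C := by
  classical
  have key : ∀ Q ⊆ P, |∑ B ∈ Q, μ B| ≤ C := by
    intro Q hQ
    have hmeas : MeasurableSet (⋃₀ (Q : Set (Set X))) :=
      Q.finite_toSet.measurableSet_sUnion fun B hB => hP B (hQ hB)
    rw [← addContent_sUnion (m := μ) (fun B hB => hP B (hQ hB))
      (hd.subset (Finset.coe_subset.2 hQ)) hmeas]
    exact hC _ hmeas
  rw [← Finset.sum_filter_add_sum_filter_not P (fun B => 0 ≤ μ B)]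
  have h1 : ∑ B ∈ P with 0 ≤ μ B, |μ B| = ∑ B ∈ P with 0 ≤ μ B, μ B :=
    Finset.sum_congr rfl fun B hB => abs_of_nonneg (Finset.mem_filter.1 hB).2
  have h2 : ∑ B ∈ P with ¬ 0 ≤ μ B, |μ B| = -∑ B ∈ P with ¬ 0 ≤ μ B, μ B := by
    rw [← Finset.sum_neg_distrib]
    exact Finset.sum_congr rfl fun B hB => abs_of_neg (not_le.1 (Finset.mem_filter.1 hB).2)
  have h3 := (abs_le.1 (key _ (Finset.filter_subset (fun B => 0 ≤ μ B) P))).2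
  have h4 := (abs_le.1 (key _ (Finset.filter_subset (fun B => ¬ 0 ≤ μ B) P))).1
  linarith

theorem sum_abs_le_totalVar {μ : FAMeasure X} (hμ : IsBdd μ) {P : Finset (Set X)}
    (hP : ∀ B ∈ P, MeasurableSet B) (hd : (P : Set (Set X)).PairwiseDisjoint id) :
    ∑ B ∈ P, |μ B| ≤ totalVar μ (⋃₀ (P : Set (Set X))) := by
  obtain ⟨C, hC⟩ := hμ
  refine le_csSup ⟨2 * C, ?_⟩ ⟨P, hP, hd, rfl, rfl⟩
  rintro r ⟨Q, hQ, hQd, -, rfl⟩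
  exact sum_abs_le_of_bound hC hQ hQd

theorem totalVar_le {μ : FAMeasure X} {A : Set X} (hA : MeasurableSet A) {c : ℝ}
    (h : ∀ P : Finset (Set X), (∀ B ∈ P, MeasurableSet B) →
      (P : Set (Set X)).PairwiseDisjoint id → ⋃₀ (P : Set (Set X)) = A → ∑ B ∈ P, |μ B| ≤ c) :
    totalVar μ A ≤ c := by
  refine csSup_le ⟨|μ A|, {A}, ?_, ?_, ?_, ?_⟩ ?_
  · simpa using hA
  · simp
  · simp
  · simp
  · rintro r ⟨P, hP, hd, hU, rfl⟩
    exact h P hP hd hU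

theorem abs_le_totalVar {μ : FAMeasure X} (hμ : IsBdd μ) {A : Set X} (hA : MeasurableSet A) :
    |μ A| ≤ totalVar μ A := by
  simpa using sum_abs_le_totalVar hμ (P := {A}) (by simpa using hA) (by simp)

theorem totalVar_of_nonneg {μ : FAMeasure X} (hμ : IsBdd μ) (h0 : IsNonneg μ) {A : Set X}
    (hA : MeasurableSet A) : totalVar μ A = μ A := by
  refine le_antisymm (totalVar_le hA fun P hP hd hU => ?_)
    ((le_abs_self _).trans (abs_le_totalVar hμ hA))
  rw [← hU, addContent_sUnion (m := μ) (fun B hB => hP B hB) hd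
    (show MeasurableSet _ by rwa [hU])]
  exact (Finset.sum_congr rfl fun B hB => abs_of_nonneg (h0 B (hP B hB))).le

theorem sum_abs_inter_le_totalVar {μ : FAMeasure X} (hμ : IsBdd μ) {P : Finset (Set X)}
    (hP : ∀ B ∈ P, MeasurableSet B) (hd : (P : Set (Set X)).PairwiseDisjoint id) {A : Set X}
    (hA : MeasurableSet A) (hAP : A ⊆ ⋃₀ (P : Set (Set X))) :
    ∑ B ∈ P, |μ (B ∩ A)| ≤ totalVar μ A := by
  classical
  have hd' : (P : Set (Set X)).PairwiseDisjoint (fun B => B ∩ A) :=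
    fun B hB C hC hBC => (hd hB hC hBC).mono inter_subset_left inter_subset_left
  have hsum : ∑ B ∈ P.image (fun B => B ∩ A), |μ B| = ∑ B ∈ P, |μ (B ∩ A)| := by
    -- Different members of `P` can have the same trace on `A` only if that trace is empty, so
    -- collapsing them in the image loses nothing.
    rw [Finset.sum_image_of_pairwise_eq_zero]
    intro B hB C hC hBC h
    have : B ∩ A = ∅ := by
      have := hd' hB hC hBC
      simp only [Function.onFun] at this
      rw [← h] at this
      simpa using this
    simp [this]
  have h := sum_abs_le_totalVar hμ (P := P.image (fun B => B ∩ A)) ?_ ?_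
  · rw [hsum] at h
    convert h using 2
    ext x
    simp only [Finset.coe_image, sUnion_image, mem_iUnion, mem_inter_iff, exists_prop,
      Finset.mem_coe]
    refine ⟨fun hx => ?_, fun ⟨B, _, _, hx⟩ => hx⟩
    obtain ⟨B, hB, hxB⟩ := hAP hx
    exact ⟨B, hB, hxB, hx⟩
  · intro B hB
    obtain ⟨C, hC, rfl⟩ := Finset.mem_image.1 hB
    exact (hP C hC).inter hA
  · rw [Finset.coe_image]
    rintro _ ⟨B, hB, rfl⟩ _ ⟨C, hC, rfl⟩ hne
    exact hd' hB hC fun h => hne (by rw [h])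

theorem totalVar_union_ge {μ : FAMeasure X} (hμ : IsBdd μ) {A B : Set X} (hA : MeasurableSet A)
    (hB : MeasurableSet B) (hAB : Disjoint A B) :
    totalVar μ A + totalVar μ B ≤ totalVar μ (A ∪ B) := by
  classical
  have h1 : totalVar μ A ≤ totalVar μ (A ∪ B) - totalVar μ B := by
    refine totalVar_le hA fun P hP hPd hPA => ?_
    suffices totalVar μ B ≤ totalVar μ (A ∪ B) - ∑ C ∈ P, |μ C| by linarith
    refine totalVar_le hB fun Q hQ hQd hQB => ?_
    -- The only set that partitions of disjoint `A` and `B` can share is `∅`.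
    have hzero : ∑ C ∈ P ∩ Q, |μ C| = 0 := by
      refine Finset.sum_eq_zero fun C hC => ?_
      obtain ⟨hCP, hCQ⟩ := Finset.mem_inter.1 hC
      have : C ⊆ ∅ := by
        rw [← hAB.inter_eq]
        exact subset_inter (hPA ▸ subset_sUnion_of_mem hCP) (hQB ▸ subset_sUnion_of_mem hCQ)
      simp [subset_empty_iff.1 this]
    have hsum := Finset.sum_union_inter (s₁ := P) (s₂ := Q) (f := fun C => |μ C|)
    have h := sum_abs_le_totalVar hμ (P := P ∪ Q) ?_ ?_
    · rw [Finset.coe_union, sUnion_union, hPA, hQB] at h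
      linarith
    · intro C hC
      exact (Finset.mem_union.1 hC).elim (hP C) (hQ C)
    · rw [Finset.coe_union]
      refine hPd.union hQd fun C hC D hD _ => ?_
      exact hAB.mono (hPA ▸ subset_sUnion_of_mem hC) (hQB ▸ subset_sUnion_of_mem hD)
  linarith

/-- Joining partitions of `A` and `B` gives `≥`; cutting each member of a partition of `A ∪ B` along
`A` and `B` gives `≤`. -/
theorem isFinAdditive_totalVar {μ : FAMeasure X} (hμ : IsBdd μ) : IsFinAdditive (totalVar μ) := by
  have hle : ∀ A B, MeasurableSet A → MeasurableSet B → Disjoint A B →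
      totalVar μ (A ∪ B) ≤ totalVar μ A + totalVar μ B := by
    intro A B hA hB hAB
    refine totalVar_le (hA.union hB) fun P hP hd hU => ?_
    have h1 := sum_abs_inter_le_totalVar hμ hP hd hA (hU ▸ subset_union_left)
    have h2 := sum_abs_inter_le_totalVar hμ hP hd hB (hU ▸ subset_union_right)
    refine le_trans ?_ (add_le_add h1 h2)
    rw [← Finset.sum_add_distrib]
    refine Finset.sum_le_sum fun C hC => ?_
    have hsplit : C = C ∩ A ∪ C ∩ B := by
      rw [← inter_union_distrib_left, ← hU, inter_eq_left.2]
      exact subset_sUnion_of_mem hC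
    have := (isFinAdditive_coe μ).union (C ∩ A) (C ∩ B) ((hP C hC).inter hA)
      ((hP C hC).inter hB) (hAB.mono inter_subset_right inter_subset_right)
    rw [← hsplit] at this
    rw [this]
    exact abs_add_le _ _
  refine ⟨?_, fun A B hA hB hAB => le_antisymm (hle A B hA hB hAB)
    (totalVar_union_ge hμ hA hB hAB)⟩
  have h := totalVar_union_ge hμ (μ := μ) .empty .empty (disjoint_empty ∅)
  rw [union_empty] at h
  linarith [totalVar_nonneg μ ∅]

theorem totalVar_eq_zero_of_null {μ : FAMeasure X} {lam : Measure X} (hμ : IsWeaklyAC μ lam)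
    {A : Set X} (hA : MeasurableSet A) (h0 : lam A = 0) : totalVar μ A = 0 := by
  refine le_antisymm (totalVar_le hA fun P hP _ hU => ?_) (totalVar_nonneg _ _)
  refine (Finset.sum_eq_zero fun B hB => ?_).le
  rw [hμ B (hP B hB) (measure_mono_null (hU ▸ subset_sUnion_of_mem hB) h0), abs_zero]

theorem abs_simpleIntegral_le {μ : FAMeasure X} (hμ : IsBdd μ) (s : SimpleFunc X ℝ) :
    |simpleIntegral (fun A => μ A) s| ≤ simpleIntegral (totalVar μ) (s.map fun t => |t|) := by
  rw [(isFinAdditive_totalVar hμ).simpleIntegral_map s abs_zero]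
  refine (Finset.abs_sum_le_sum_abs _ _).trans (Finset.sum_le_sum fun y _ => ?_)
  rw [abs_mul]
  exact mul_le_mul_of_nonneg_left (abs_le_totalVar hμ (s.measurableSet_fiber y)) (abs_nonneg y)

end SetFunctions

end FinAdd

namespace FinAdd

section Integration

variable {X : Type*} [MeasurableSpace X] {μ : FAMeasure X}

/-! ### The outer measure of the total variation -/

theorem outerVar_nonneg (μ : FAMeasure X) (B : Set X) : 0 ≤ outerVar μ B := by
  refine Real.sInf_nonneg ?_
  rintro r ⟨A, -, -, rfl⟩
  exact totalVar_nonneg μ A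

theorem outerVar_le_totalVar {A B : Set X} (hA : MeasurableSet A) (h : B ⊆ A) :
    outerVar μ B ≤ totalVar μ A := by
  refine csInf_le ⟨0, ?_⟩ ⟨A, hA, h, rfl⟩
  rintro r ⟨A, -, -, rfl⟩
  exact totalVar_nonneg μ A

theorem le_outerVar {B : Set X} {c : ℝ}
    (h : ∀ A, MeasurableSet A → B ⊆ A → c ≤ totalVar μ A) : c ≤ outerVar μ B := by
  refine le_csInf ⟨_, univ, .univ, subset_univ _, rfl⟩ ?_
  rintro r ⟨A, hA, hBA, rfl⟩
  exact h A hA hBA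

theorem totalVar_mono (hμ : IsBdd μ) {A B : Set X} (hA : MeasurableSet A) (hB : MeasurableSet B)
    (h : A ⊆ B) : totalVar μ A ≤ totalVar μ B :=
  (isFinAdditive_totalVar hμ).mono (fun _ _ => totalVar_nonneg μ _) hA hB h

theorem outerVar_eq_totalVar (hμ : IsBdd μ) {A : Set X} (hA : MeasurableSet A) :
    outerVar μ A = totalVar μ A :=
  le_antisymm (outerVar_le_totalVar hA Subset.rfl)
    (le_outerVar fun _ hB h => totalVar_mono hμ hA hB h)

theorem outerVar_mono {A B : Set X} (h : A ⊆ B) : outerVar μ A ≤ outerVar μ B :=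
  le_outerVar fun _ hC hBC => outerVar_le_totalVar hC (h.trans hBC)

theorem outerVar_union_le (hμ : IsBdd μ) (A B : Set X) :
    outerVar μ (A ∪ B) ≤ outerVar μ A + outerVar μ B := by
  suffices outerVar μ (A ∪ B) - outerVar μ B ≤ outerVar μ A by linarith
  refine le_outerVar fun A' hA' hAA' => ?_
  suffices outerVar μ (A ∪ B) - totalVar μ A' ≤ outerVar μ B by linarith
  refine le_outerVar fun B' hB' hBB' => ?_
  have h1 := outerVar_le_totalVar (μ := μ) (hA'.union hB') (union_subset_union hAA' hBB')
  have h2 := (isFinAdditive_totalVar hμ).union_le (fun _ _ => totalVar_nonneg μ _) hA' hB'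
  linarith

theorem ConvInMeasure.congr_null (hμ : IsBdd μ) {f g : X → ℝ} {s : ℕ → X → ℝ} {N : Set X}
    (hN : MeasurableSet N) (h0 : totalVar μ N = 0) (hfg : ∀ x ∉ N, f x = g x)
    (h : ConvInMeasure μ s f) : ConvInMeasure μ s g := by
  intro ε hε
  refine squeeze_zero (fun _ => outerVar_nonneg _ _) (fun k => ?_) (h ε hε)
  refine (outerVar_mono (B := {x | ε < |s k x - f x|} ∪ N) fun x hx => ?_).trans
    ((outerVar_union_le hμ _ _).trans ?_)
  · by_cases hxN : x ∈ N
    · exact Or.inr hxN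
    · refine Or.inl ?_
      simpa only [mem_ofPred_eq, hfg x hxN] using hx
  · rw [outerVar_eq_totalVar hμ hN, h0, add_zero]

theorem convInMeasure_of_abs_sub_le (hμ : IsBdd μ) {f : X → ℝ} {s : ℕ → X → ℝ} {u : ℕ → ℝ}
    (hu : Tendsto u atTop (𝓝 0)) (h : ∀ k x, |s k x - f x| ≤ u k) : ConvInMeasure μ s f := by
  intro ε hε
  refine tendsto_const_nhds.congr' ?_
  filter_upwards [hu.eventually (gt_mem_nhds hε)] with k hk
  have : {x | ε < |s k x - f x|} = ∅ :=
    eq_empty_of_forall_notMem fun x hx => (lt_irrefl ε) (lt_of_lt_of_le hx ((h k x).trans hk.le))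
  rw [this, outerVar_eq_totalVar hμ .empty, (isFinAdditive_totalVar hμ).empty]

theorem ConvInMeasure.sub (hμ : IsBdd μ) {f : X → ℝ} {s t : ℕ → X → ℝ}
    (hs : ConvInMeasure μ s f) (ht : ConvInMeasure μ t f) :
    ConvInMeasure μ (fun k x => s k x - t k x) 0 := by
  intro ε hε
  have h := (hs (ε / 2) (half_pos hε)).add (ht (ε / 2) (half_pos hε))
  rw [add_zero] at h
  refine squeeze_zero (fun _ => outerVar_nonneg _ _) (fun k => ?_) h
  refine (outerVar_mono fun x hx => ?_).trans (outerVar_union_le hμ _ _)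
  simp only [mem_ofPred_eq, Pi.zero_apply, sub_zero, mem_union] at hx ⊢
  by_contra! hc
  have := abs_sub_le (s k x) (f x) (t k x)
  rw [abs_sub_comm (f x)] at this
  linarith [hc.1, hc.2]

/-! ### The `L¹` seminorm of simple functions -/

/-- The seminorm `∫ |s| d|μ|` of a simple function. -/
noncomputable def simpleNorm (μ : FAMeasure X) (s : SimpleFunc X ℝ) : ℝ :=
  simpleIntegral (totalVar μ) (s.map fun t => |t|)

theorem simpleNorm_nonneg (hμ : IsBdd μ) (s : SimpleFunc X ℝ) : 0 ≤ simpleNorm μ s :=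
  (isFinAdditive_totalVar hμ).simpleIntegral_nonneg (fun _ _ => totalVar_nonneg μ _)
    fun _ => abs_nonneg _

theorem simpleNorm_le_of_abs_le (hμ : IsBdd μ) {s : SimpleFunc X ℝ} {c : ℝ}
    (h : ∀ x, |s x| ≤ c) : simpleNorm μ s ≤ c * totalVar μ univ := by
  rw [← (isFinAdditive_totalVar hμ).simpleIntegral_const c]
  exact (isFinAdditive_totalVar hμ).simpleIntegral_mono (fun _ _ => totalVar_nonneg μ _) h

/-- Pointwise, `|s| ≤ |s - t| + M` where `|s| > η`, and `|s| ≤ η` elsewhere. -/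
theorem simpleNorm_le_add_add (hμ : IsBdd μ) (s t : SimpleFunc X ℝ) {η M : ℝ} (hη : 0 ≤ η)
    (hM : ∀ x, |t x| ≤ M) :
    simpleNorm μ s ≤ simpleNorm μ (s - t) + M * totalVar μ {x | η < |s x|} +
      η * totalVar μ univ := by
  have h := isFinAdditive_totalVar hμ
  have hA : MeasurableSet {x | η < |s x|} :=
    s.measurableSet_preimage {y | η < |y|}
  rw [← h.simpleIntegral_const η, ← h.simpleIntegral_indicator hA M, simpleNorm, simpleNorm,
    ← h.simpleIntegral_add, ← h.simpleIntegral_add]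
  refine h.simpleIntegral_mono (fun _ _ => totalVar_nonneg μ _) fun x => ?_
  simp only [SimpleFunc.coe_add, SimpleFunc.map_apply, Pi.add_apply, SimpleFunc.coe_sub,
    Pi.sub_apply, SimpleFunc.coe_piecewise, SimpleFunc.coe_const, Function.const_apply]
  by_cases hx : x ∈ {x | η < |s x|}
  · rw [piecewise_eq_of_mem _ _ _ hx]
    have h1 := abs_sub_abs_le_abs_sub (s x) (t x)
    have h2 := hM x
    simp only [Function.const_apply]
    linarith
  · rw [piecewise_eq_of_notMem _ _ _ hx]
    have h1 : |s x| ≤ η := not_lt.1 hx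
    simp only [Function.const_apply]
    linarith [abs_nonneg (s x - t x)]

/-- A sequence of simple functions which is Cauchy in the `L¹` seminorm and tends to `0` in
measure tends to `0` in the `L¹` seminorm. -/
theorem tendsto_simpleNorm_zero (hμ : IsBdd μ) {h : ℕ → SimpleFunc X ℝ}
    (hm : ConvInMeasure μ (fun k => h k) 0)
    (hc : Tendsto (fun p : ℕ × ℕ => simpleNorm μ (h p.1 - h p.2)) atTop (𝓝 0)) :
    Tendsto (fun k => simpleNorm μ (h k)) atTop (𝓝 0) := by
  rw [Metric.tendsto_atTop]
  intro ε hε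
  have hV := totalVar_nonneg μ univ
  obtain ⟨⟨N, N'⟩, hN⟩ := Filter.eventually_atTop.1
    (hc.eventually (gt_mem_nhds (show (0 : ℝ) < ε / 3 by positivity)))
  -- The index `K` is frozen, so the bound `M` of `h K` does not depend on `k`: the Cauchy condition
  -- controls `h k - h K`, and convergence in measure controls where `h k` is large.
  set K := max N N'
  obtain ⟨M, hM⟩ := (h K).exists_forall_norm_le
  -- The `+ 1` covers the case of zero total variation.
  have hη : 0 < ε / 3 / (totalVar μ univ + 1) := by positivity
  have hlim : Tendsto (fun k => |M| * outerVar μ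
      {x | ε / 3 / (totalVar μ univ + 1) < |h k x - (0 : X → ℝ) x|}) atTop (𝓝 0) := by
    simpa using (hm _ hη).const_mul |M|
  obtain ⟨K', hK'⟩ := Filter.eventually_atTop.1
    (hlim.eventually (gt_mem_nhds (show (0 : ℝ) < ε / 3 by positivity)))
  refine ⟨max K K', fun k hk => ?_⟩
  rw [Real.dist_eq, sub_zero, abs_of_nonneg (simpleNorm_nonneg hμ _)]
  have h1 := hN (k, K) ⟨(le_max_left N N').trans ((le_max_left K K').trans hk),
    le_max_right N N'⟩
  have h2 := hK' k ((le_max_right K K').trans hk)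
  have h3 := simpleNorm_le_add_add hμ (h k) (h K) hη.le (M := |M|)
    fun x => (hM x).trans (le_abs_self M)
  simp only [Pi.zero_apply, sub_zero] at h2
  have hA : MeasurableSet {x | ε / 3 / (totalVar μ univ + 1) < |h k x|} :=
    (h k).measurableSet_preimage {y | ε / 3 / (totalVar μ univ + 1) < |y|}
  rw [outerVar_eq_totalVar hμ hA] at h2
  have h4 : ε / 3 / (totalVar μ univ + 1) * totalVar μ univ ≤ ε / 3 := by
    rw [div_mul_eq_mul_div, div_le_iff₀ (by positivity)]
    nlinarith
  simp only at h1
  linarith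

/-! ### Determining sequences -/

theorem IsDetermining.congr_null (hμ : IsBdd μ) {f g : X → ℝ} {s : ℕ → SimpleFunc X ℝ} {N : Set X}
    (hN : MeasurableSet N) (h0 : totalVar μ N = 0) (hfg : ∀ x ∉ N, f x = g x)
    (h : IsDetermining μ f s) : IsDetermining μ g s :=
  ⟨h.1.congr_null hμ hN h0 hfg, h.2⟩

theorem IsDetermining.neg {f : X → ℝ} {s : ℕ → SimpleFunc X ℝ} (h : IsDetermining μ f s) :
    IsDetermining μ (-f) (fun k => -s k) := by
  refine ⟨fun ε hε => (h.1 ε hε).congr fun k => ?_, h.2.congr fun p => ?_⟩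
  · congr 1
    ext x
    simp only [mem_ofPred_eq, SimpleFunc.coe_neg, Pi.neg_apply]
    rw [← abs_neg, neg_sub, neg_sub_neg, abs_sub_comm]
  · congr 1
    refine SimpleFunc.ext fun x => ?_
    simp only [SimpleFunc.map_apply, SimpleFunc.coe_sub, SimpleFunc.coe_neg, Pi.sub_apply,
      Pi.neg_apply]
    rw [neg_sub_neg, abs_sub_comm]

theorem isDetermining_of_abs_sub_le (hμ : IsBdd μ) {f : X → ℝ} {s : ℕ → SimpleFunc X ℝ}
    {u : ℕ → ℝ} (hu : Tendsto u atTop (𝓝 0)) (h : ∀ k x, |s k x - f x| ≤ u k) :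
    IsDetermining μ f s := by
  refine ⟨convInMeasure_of_abs_sub_le hμ hu h, ?_⟩
  have hlim : Tendsto (fun p : ℕ × ℕ => (u p.1 + u p.2) * totalVar μ univ) atTop (𝓝 0) := by
    rw [← prod_atTop_atTop_eq]
    simpa using ((hu.comp tendsto_fst).add (hu.comp tendsto_snd)).mul_const (totalVar μ univ)
  refine squeeze_zero (fun p => simpleNorm_nonneg hμ _)
    (fun p => simpleNorm_le_of_abs_le hμ fun x => ?_) hlim
  have h1 := abs_sub_le (s p.1 x) (f x) (s p.2 x)
  rw [abs_sub_comm (f x)] at h1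
  exact h1.trans (add_le_add (h _ _) (h _ _))

theorem IsDetermining.tendsto_simpleNorm_sub (hμ : IsBdd μ) {f : X → ℝ}
    {s t : ℕ → SimpleFunc X ℝ} (hs : IsDetermining μ f s) (ht : IsDetermining μ f t) :
    Tendsto (fun k => simpleNorm μ (s k - t k)) atTop (𝓝 0) := by
  refine tendsto_simpleNorm_zero hμ (hs.1.sub hμ ht.1) ?_
  have h := hs.2.add ht.2
  rw [add_zero] at h
  refine squeeze_zero (fun p => simpleNorm_nonneg hμ _) (fun p => ?_) h
  have ha := isFinAdditive_totalVar hμ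
  rw [simpleNorm, ← ha.simpleIntegral_add]
  refine ha.simpleIntegral_mono (fun _ _ => totalVar_nonneg μ _) fun x => ?_
  change |s p.1 x - t p.1 x - (s p.2 x - t p.2 x)| ≤ |s p.1 x - s p.2 x| + |t p.1 x - t p.2 x|
  rw [sub_sub_sub_comm]
  exact abs_sub _ _

theorem abs_simpleIntegral_sub_le (hμ : IsBdd μ) (s t : SimpleFunc X ℝ) :
    |simpleIntegral (fun A => μ A) s - simpleIntegral (fun A => μ A) t| ≤
      simpleNorm μ (s - t) := by
  rw [← (isFinAdditive_coe μ).simpleIntegral_sub]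
  exact abs_simpleIntegral_le hμ _

theorem IsDetermining.exists_tendsto (hμ : IsBdd μ) {f : X → ℝ} {s : ℕ → SimpleFunc X ℝ}
    (hs : IsDetermining μ f s) :
    ∃ L, Tendsto (fun k => simpleIntegral (fun A => μ A) (s k)) atTop (𝓝 L) := by
  refine cauchySeq_tendsto_of_complete (cauchySeq_iff_tendsto_dist_atTop_0.2 ?_)
  exact squeeze_zero (fun _ => dist_nonneg)
    (fun p => by rw [Real.dist_eq]; exact abs_simpleIntegral_sub_le hμ _ _) hs.2

/-- The chosen sequence and `s` differ by a sequence tending to 0 in the `L¹` seminorm, so their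
integrals have the same limit. -/
theorem IsDetermining.integral_eq (hμ : IsBdd μ) {f : X → ℝ} {s : ℕ → SimpleFunc X ℝ}
    (hs : IsDetermining μ f s) {L : ℝ}
    (hL : Tendsto (fun k => simpleIntegral (fun A => μ A) (s k)) atTop (𝓝 L)) :
    integral μ f = L := by
  have hf : IsIntegrable μ f := ⟨s, hs⟩
  rw [integral, dif_pos hf]
  refine Tendsto.limUnder_eq ?_
  have h := squeeze_zero_norm
    (fun k => (Real.norm_eq_abs _).trans_le (abs_simpleIntegral_sub_le hμ (hf.choose k) (s k)))
    (hf.choose_spec.tendsto_simpleNorm_sub hμ hs)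
  simpa using h.add hL

/-! ### Properties of the integral -/

theorem integral_neg (hμ : IsBdd μ) {f : X → ℝ} (hf : IsIntegrable μ f) :
    integral μ (-f) = -integral μ f := by
  obtain ⟨s, hs⟩ := hf
  obtain ⟨L, hL⟩ := hs.exists_tendsto hμ
  rw [hs.integral_eq hμ hL]
  refine hs.neg.integral_eq hμ (hL.neg.congr fun k => ?_)
  rw [(isFinAdditive_coe μ).simpleIntegral_neg]

theorem isIntegrable_congr_null (hμ : IsBdd μ) {f g : X → ℝ} {N : Set X} (hN : MeasurableSet N)
    (h0 : totalVar μ N = 0) (hfg : ∀ x ∉ N, f x = g x) (hf : IsIntegrable μ f) :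
    IsIntegrable μ g := by
  obtain ⟨s, hs⟩ := hf
  exact ⟨s, hs.congr_null hμ hN h0 hfg⟩

theorem integral_congr_null (hμ : IsBdd μ) {f g : X → ℝ} {N : Set X} (hN : MeasurableSet N)
    (h0 : totalVar μ N = 0) (hfg : ∀ x ∉ N, f x = g x) (hf : IsIntegrable μ f) :
    integral μ g = integral μ f := by
  obtain ⟨s, hs⟩ := hf
  obtain ⟨L, hL⟩ := hs.exists_tendsto hμ
  rw [hs.integral_eq hμ hL, (hs.congr_null hμ hN h0 hfg).integral_eq hμ hL]

theorem integral_simpleFunc (hμ : IsBdd μ) (s : SimpleFunc X ℝ) :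
    integral μ s = simpleIntegral (fun A => μ A) s :=
  (isDetermining_of_abs_sub_le hμ (s := fun _ => s) (u := fun _ => 0) tendsto_const_nhds
    (by simp)).integral_eq hμ tendsto_const_nhds

theorem integral_indicator_const (hμ : IsBdd μ) {A : Set X} (hA : MeasurableSet A) (c : ℝ) :
    integral μ (A.indicator fun _ => c) = c * μ A := by
  rw [← (isFinAdditive_coe μ).simpleIntegral_indicator hA c, ← integral_simpleFunc hμ]
  congr 1

/-- A bounded measurable function is a uniform limit of simple functions. -/
theorem exists_simpleFunc_abs_sub_le {g : X → ℝ} (hg : Measurable g) {C : ℝ}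
    (hC : ∀ x, |g x| ≤ C) (k : ℕ) :
    ∃ s : SimpleFunc X ℝ, ∀ x, |s x - g x| ≤ 1 / ((k : ℝ) + 1) := by
  have hk : (0 : ℝ) < (k : ℝ) + 1 := by positivity
  -- Round `g` down to the grid of mesh `1 / (k + 1)`; boundedness leaves finitely many values.
  have hmeas : Measurable fun x => ((⌊((k : ℝ) + 1) * g x⌋ : ℤ) : ℝ) / ((k : ℝ) + 1) := by
    fun_prop
  refine ⟨⟨_, fun y => hmeas (measurableSet_singleton y), ?_⟩, fun x => ?_⟩
  · refine ((finite_Icc ⌊((k : ℝ) + 1) * (-C)⌋ ⌊((k : ℝ) + 1) * C⌋).image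
      (fun z : ℤ => (z : ℝ) / ((k : ℝ) + 1))).subset ?_
    rintro _ ⟨x, rfl⟩
    refine ⟨_, ⟨Int.floor_mono ?_, Int.floor_mono ?_⟩, rfl⟩
    · exact mul_le_mul_of_nonneg_left (abs_le.1 (hC x)).1 hk.le
    · exact mul_le_mul_of_nonneg_left (abs_le.1 (hC x)).2 hk.le
  · change |((⌊((k : ℝ) + 1) * g x⌋ : ℤ) : ℝ) / ((k : ℝ) + 1) - g x| ≤ _
    have h1 := Int.floor_le (((k : ℝ) + 1) * g x)
    have h2 := Int.lt_floor_add_one (((k : ℝ) + 1) * g x)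
    rw [div_sub' hk.ne', abs_div, abs_of_pos hk]
    refine div_le_div_of_nonneg_right ?_ hk.le
    rw [abs_le]
    constructor <;> linarith

theorem isIntegrable_of_bounded (hμ : IsBdd μ) {g : X → ℝ} (hg : Measurable g) {C : ℝ}
    (hC : ∀ x, |g x| ≤ C) : IsIntegrable μ g := by
  choose s hs using exists_simpleFunc_abs_sub_le hg hC
  exact ⟨s, isDetermining_of_abs_sub_le hμ tendsto_one_div_add_atTop_nhds_zero_nat hs⟩

/-- Off a measurable `lam`-null set `N`, `f` agrees with a bounded measurable function. Weak
absolute continuity makes `N` null for `|μ|` too, and null sets do not affect integrability. -/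
theorem isIntegrable_of_memLp_top {lam : Measure X} (hμ : μ ∈ baw lam) {f : X → ℝ}
    (hf : MemLp f ∞ lam) : IsIntegrable μ f := by
  set g := hf.1.mk f with hgdef
  have hg : Measurable g := hf.1.stronglyMeasurable_mk.measurable
  have hbd : ∀ᵐ x ∂lam, ‖f x‖ ≤ (eLpNorm f ∞ lam).toReal := by
    have h := ae_le_eLpNormEssSup (f := f) (μ := lam)
    filter_upwards [h] with x hx
    rw [← eLpNorm_exponent_top] at hx
    simpa using ENNReal.toReal_mono hf.2.ne hx
  have hae : ∀ᵐ x ∂lam, f x = g x ∧ |g x| ≤ (eLpNorm f ∞ lam).toReal := by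
    filter_upwards [hf.1.ae_eq_mk, hbd] with x h1 h2
    exact ⟨h1, by rw [hgdef, ← h1]; exact h2⟩
  set N := toMeasurable lam {x | ¬ (f x = g x ∧ |g x| ≤ (eLpNorm f ∞ lam).toReal)} with hNdef
  have hN : MeasurableSet N := measurableSet_toMeasurable _ _
  have hsub : ∀ x ∉ N, f x = g x ∧ |g x| ≤ (eLpNorm f ∞ lam).toReal := fun x hx => by
    by_contra hc
    exact hx (subset_toMeasurable _ _ hc)
  have hN0 : totalVar μ N = 0 :=
    totalVar_eq_zero_of_null hμ.2 hN (by rw [hNdef, measure_toMeasurable]; exact hae)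
  refine isIntegrable_congr_null hμ.1 (f := Nᶜ.indicator g) hN hN0 (fun x hx => ?_)
    (isIntegrable_of_bounded hμ.1 (hg.indicator hN.compl) (C := (eLpNorm f ∞ lam).toReal) ?_)
  · rw [indicator_of_mem (by exact hx), (hsub x hx).1]
  · intro x
    by_cases hx : x ∈ N
    · simp [hx]
    · rw [indicator_of_mem (by exact hx)]
      exact (hsub x hx).2

end Integration

end FinAdd

namespace FinAdd

/-! ### Neighbourhoods of `F`, means over them, and density measures. -/

section DensityMeasures

variable {n : ℕ} {Ω F : Set (EuclideanSpace ℝ (Fin n))} {μ ν : FAMeasure Ω}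

theorem measurableSet_nhdIn (Ω F : Set (EuclideanSpace ℝ (Fin n))) (δ : ℝ) :
    MeasurableSet (nhdIn Ω F δ) :=
  (Metric.isOpen_thickening.preimage continuous_subtype_val).measurableSet

theorem nhdIn_mono (Ω F : Set (EuclideanSpace ℝ (Fin n))) {δ ε : ℝ} (h : δ ≤ ε) :
    nhdIn Ω F δ ⊆ nhdIn Ω F ε :=
  preimage_mono (Metric.thickening_mono h F)

theorem isIntegrable_nhdIn_indicator (hμ : μ ∈ baw (lebOn Ω)) {f : Ω → ℝ}
    (hf : MemLp f ∞ (lebOn Ω)) (δ : ℝ) : IsIntegrable μ ((nhdIn Ω F δ).indicator f) :=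
  isIntegrable_of_memLp_top hμ (hf.indicator (measurableSet_nhdIn Ω F δ))

theorem setMean_neg (hν : ν ∈ baw (lebOn Ω)) {f : Ω → ℝ} (hf : MemLp f ∞ (lebOn Ω)) (δ : ℝ) :
    setMean ν (nhdIn Ω F δ) (-f) = -setMean ν (nhdIn Ω F δ) f := by
  rw [setMean, setMean, setIntegral, setIntegral, indicator_neg',
    integral_neg hν.1 (isIntegrable_nhdIn_indicator hν hf δ), neg_div]

theorem setMean_indicator_const (hν : IsBdd ν) {A : Set Ω} (hA : MeasurableSet A) (c δ : ℝ) :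
    setMean ν (nhdIn Ω F δ) (A.indicator fun _ => c) =
      c * ν (nhdIn Ω F δ ∩ A) / ν (nhdIn Ω F δ) := by
  rw [setMean, setIntegral, indicator_indicator,
    integral_indicator_const hν ((measurableSet_nhdIn Ω F δ).inter hA)]

namespace IsDensityMeasure

theorem totalVar_compl_nhdIn (hμ : IsDensityMeasure μ F) {δ : ℝ} (hδ : 0 < δ) :
    totalVar μ (nhdIn Ω F δ)ᶜ = 0 := by
  have hm := measurableSet_nhdIn Ω F δ
  rw [totalVar_of_nonneg hμ.mem_baw.1 hμ.nonneg hm.compl]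
  have h := (isFinAdditive_coe μ).union _ _ hm hm.compl disjoint_compl_right
  simp only [union_compl_self, hμ.total, hμ.conc δ hδ] at h
  linarith

theorem setIntegral_nhdIn (hμ : IsDensityMeasure μ F) {f : Ω → ℝ} (hf : MemLp f ∞ (lebOn Ω))
    {δ : ℝ} (hδ : 0 < δ) : setIntegral μ (nhdIn Ω F δ) f = integral μ f := by
  refine integral_congr_null hμ.mem_baw.1 (measurableSet_nhdIn Ω F δ).compl
    (hμ.totalVar_compl_nhdIn hδ) (fun x hx => ?_) (isIntegrable_of_memLp_top hμ.mem_baw hf)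
  rw [indicator_of_mem (not_notMem.1 hx)]

theorem core_subset (hμ : IsDensityMeasure μ F) (hF : IsClosed F) : core μ ⊆ F := by
  intro x hx
  by_contra hxF
  obtain ⟨δ, hδ, hball⟩ := Metric.isOpen_iff.1 hF.isOpen_compl x hxF
  have hpos := hx (Metric.ball x (δ / 2)) Metric.isOpen_ball
    (Metric.mem_ball_self (half_pos hδ))
  -- A point within `δ / 2` of both `x` and some `z ∈ F` would put `z` in the ball of radius `δ`
  -- about `x`, which misses `F`.
  have hsub : (Subtype.val ⁻¹' Metric.ball x (δ / 2) : Set Ω) ⊆ (nhdIn Ω F (δ / 2))ᶜ := by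
    intro y hy hy'
    obtain ⟨z, hz, hyz⟩ := Metric.mem_thickening_iff.1 hy'
    refine hball ?_ hz
    have hy : dist (y : EuclideanSpace ℝ (Fin n)) x < δ / 2 := hy
    have := dist_triangle_left z x (y : EuclideanSpace ℝ (Fin n))
    rw [Metric.mem_ball]
    linarith
  have h := totalVar_mono hμ.mem_baw.1
    (Metric.isOpen_ball.preimage continuous_subtype_val).measurableSet
    (measurableSet_nhdIn Ω F (δ / 2)).compl hsub
  rw [hμ.totalVar_compl_nhdIn (half_pos hδ)] at h
  exact absurd hpos (not_lt.2 h)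

theorem hasCoreIntegral (hμ : IsDensityMeasure μ F) (hF : IsClosed F) {f : Ω → ℝ}
    (hf : MemLp f ∞ (lebOn Ω)) : HasCoreIntegral μ F f (integral μ f) :=
  ⟨hμ.core_subset hF, fun δ hδ =>
    ⟨isIntegrable_nhdIn_indicator hμ.mem_baw hf δ, hμ.setIntegral_nhdIn hf hδ⟩⟩

theorem dominatesMeans_self (hμ : IsDensityMeasure μ F) : DominatesMeans μ μ F where
  mem_baw := hμ.mem_baw
  nonneg := hμ.nonneg
  charges δ hδ := by rw [hμ.conc δ hδ]; exact one_pos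
  le_limsup f hf := by
    refine (Tendsto.limsup_eq (tendsto_const_nhds.congr' ?_)).ge
    filter_upwards [self_mem_nhdsWithin] with δ hδ
    rw [setMean, hμ.setIntegral_nhdIn hf hδ, hμ.conc δ hδ, div_one]

end IsDensityMeasure

/-! ### Consequences of the upper bound by means. -/

namespace DominatesMeans

theorem integral_le_of_tendsto (h : DominatesMeans ν μ F) {f : Ω → ℝ}
    (hf : MemLp f ∞ (lebOn Ω)) {l : ℝ}
    (hl : Tendsto (fun δ : ℝ => setMean ν (nhdIn Ω F δ) f) (𝓝[>] (0 : ℝ)) (𝓝 l)) :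
    integral μ f ≤ l := by
  have h' := h.le_limsup f hf
  have hl' := ((continuous_coe_real_ereal.tendsto l).comp hl).limsup_eq
  exact EReal.coe_le_coe_iff.1 (h'.trans hl'.le)

/-- The one-sided bound becomes an equality because it also holds for `-f`, whose means converge to
`-l`. -/
theorem integral_eq_of_tendsto (hμ : μ ∈ baw (lebOn Ω)) (h : DominatesMeans ν μ F) {f : Ω → ℝ}
    (hf : MemLp f ∞ (lebOn Ω)) {l : ℝ}
    (hl : Tendsto (fun δ : ℝ => setMean ν (nhdIn Ω F δ) f) (𝓝[>] (0 : ℝ)) (𝓝 l)) :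
    integral μ f = l := by
  refine le_antisymm (h.integral_le_of_tendsto hf hl) ?_
  have h' := h.integral_le_of_tendsto hf.neg
    (hl.neg.congr fun δ => (setMean_neg h.mem_baw hf δ).symm)
  rw [integral_neg hμ.1 (isIntegrable_of_memLp_top hμ hf)] at h'
  exact neg_le_neg_iff.1 h'

theorem apply_eq_one (hμ : μ ∈ baw (lebOn Ω)) (h : DominatesMeans ν μ F) {A : Set Ω}
    (hA : MeasurableSet A) {δ : ℝ} (hδ : 0 < δ) (hsub : nhdIn Ω F δ ⊆ A) : μ A = 1 := by
  have hf : MemLp (A.indicator fun _ => (1 : ℝ)) ∞ (lebOn Ω) := (memLp_top_const 1).indicator hA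
  have hl := h.integral_eq_of_tendsto hμ hf (l := 1) ?_
  · rwa [integral_indicator_const hμ.1 hA, one_mul] at hl
  · refine tendsto_const_nhds.congr' ?_
    filter_upwards [Ioo_mem_nhdsGT hδ] with ε hε
    rw [setMean_indicator_const h.mem_baw.1 hA,
      inter_eq_left.2 ((nhdIn_mono Ω F hε.2.le).trans hsub), one_mul,
      div_self (h.charges ε hε.1).ne']

theorem isNonneg (hμ : μ ∈ baw (lebOn Ω)) (h : DominatesMeans ν μ F) : IsNonneg μ := by
  intro A hA
  -- Only upper bounds are available, so `-1_A` is tested: its `ν`-means are nonpositive, whence `-μ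
  -- A ≤ 0`.
  have hf : MemLp (A.indicator fun _ => (-1 : ℝ)) ∞ (lebOn Ω) :=
    (memLp_top_const (-1)).indicator hA
  have h' := h.le_limsup _ hf
  rw [integral_indicator_const hμ.1 hA] at h'
  have hle : (((-1 : ℝ) * μ A : ℝ) : EReal) ≤ ((0 : ℝ) : EReal) := by
    refine h'.trans (limsup_le_of_le (by isBoundedDefault) ?_)
    filter_upwards [self_mem_nhdsWithin] with δ hδ
    rw [setMean_indicator_const h.mem_baw.1 hA, EReal.coe_le_coe_iff]
    refine div_nonpos_of_nonpos_of_nonneg ?_ (h.charges δ hδ).le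
    linarith [h.nonneg _ ((measurableSet_nhdIn Ω F δ).inter hA)]
  linarith [EReal.coe_le_coe_iff.1 hle]

theorem isDensityMeasure (hμ : μ ∈ baw (lebOn Ω)) (h : DominatesMeans ν μ F) :
    IsDensityMeasure μ F where
  mem_baw := hμ
  nonneg := h.isNonneg hμ
  total := h.apply_eq_one hμ .univ one_pos (subset_univ _)
  conc δ hδ := h.apply_eq_one hμ (measurableSet_nhdIn Ω F δ) hδ Subset.rfl

end DominatesMeans

end DensityMeasures

end FinAdd

theorem mainTheorem5 {n : ℕ} (hn : 0 < n) (Ω F : Set (EuclideanSpace ℝ (Fin n)))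
    (hΩ : MeasurableSet Ω) (hF : IsClosed F) (hFΩ : F ⊆ closure Ω)
    (hnull : volume (F ∩ Ω) = 0)
    (μ : FinAdd.FAMeasure Ω) (hμ : μ ∈ FinAdd.baw (FinAdd.lebOn Ω)) :
    (FinAdd.IsDensityMeasure μ F ↔ ∃ ν : FinAdd.FAMeasure Ω, FinAdd.DominatesMeans ν μ F) ∧
    ∀ ν : FinAdd.FAMeasure Ω, FinAdd.DominatesMeans ν μ F →
      ∀ f : Ω → ℝ, MemLp f ∞ (FinAdd.lebOn Ω) →
        ∀ l : ℝ, Tendsto (fun δ : ℝ => FinAdd.setMean ν (FinAdd.nhdIn Ω F δ) f)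
          (𝓝[>] (0 : ℝ)) (𝓝 l) →
          FinAdd.HasCoreIntegral μ F f l := by
  refine ⟨⟨fun h => ⟨μ, h.dominatesMeans_self⟩, fun ⟨ν, h⟩ => h.isDensityMeasure hμ⟩, ?_⟩
  intro ν h f hf l hl
  rw [← h.integral_eq_of_tendsto hμ hf hl]
  exact (h.isDensityMeasure hμ).hasCoreIntegral hF hf
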